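/- **Theorem (Persistence of Excitation).** There is an absolute constant $C>0$ such that the following holds. Let $p\ge 1$, $L\ge 1$, $T\ge 0$ be integers, $\gamma>1$, $\delta\in(0,1)$, and let $(u_t)_{t\ge 0}$ be independent random vectors in $\mathbb{R}^p$ such that, for every $t\ge 0$ and every $x\in\mathbb{R}^p$, $$\mathbb{E}[u_t]=0,\qquad \mathbb{E}[(u_t^\top x)^2]=\|x\|_2^2,\qquad \mathbb{E}[(u_t^\top x)^4]\le\gamma\,\big(\mathbb{E}[(u_t^\top x)^2]\big)^2,\qquad \mathbb{E}[(u_t^\top x)^3]=0 ,$$ all these moments being finite. Put $\bar u_t=\begin{bmatrix}1\\ u_t\end{bmatrix}\in\mathbb{R}^{p+1}$ and, for $t\ge L$, let $$\tilde u_t=\begin{bmatrix}u_t\\ u_{t-1}\\ \bar u_{t-1}\otimes u_{t-2}\\ \bar u_{t-1}\otimes\bar u_{t-2}\otimes u_{t-3}\\ \vdots\\ \bar u_{t-1}\otimes\cdots\otimes\bar u_{t-L+1}\otimes u_{t-L}\end{bmatrix}\in\mathbb{R}^{(p+1)^L+p-1},$$ where $\otimes$ is the Kronecker product, and let $\tilde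 U$ be the matrix with rows $\tilde u_t^\top$, $t=L,\dots,T$. If $$T\ \ge\ C\left(L+L(L+1)\,(3\vee\gamma)^{L+1}\left(\log\frac{L+1}{\delta}+(p+1)^{L+1}\log\frac{(p+1)^{L+1}}{\delta}\right)\right),$$ where $3\vee\gamma=\max\{3,\gamma\}$, then with probability at least $1-\delta$, $$\lambda_{\min}\big(\tilde U^\top\tilde U\big)=\lambda_{\min}\Big(\sum_{t=L}^T\tilde u_t\tilde u_t^\top\Big)\ \ge\ \frac{T-L+1}{4}.$$ -/

import Mathlib

open MeasureTheory ProbabilityTheory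
open scoped RealInnerProductSpace Matrix

/-- A random vector is zero-mean: it is integrable and its expectation is `0`. -/
def IsZeroMean {Ω : Type*} [MeasurableSpace Ω] {p : ℕ} (μ : Measure Ω)
    (X : Ω → EuclideanSpace ℝ (Fin p)) : Prop :=
  Integrable X μ ∧ ∫ ω, X ω ∂μ = 0

/-- A random vector is isotropic: `E[(uᵀ x)²] = ‖x‖²` for every `x` (the expectation being that
of an integrable variable). -/
def IsIsotropic {Ω : Type*} [MeasurableSpace Ω] {p : ℕ} (μ : Measure Ω)
    (X : Ω → EuclideanSpace ℝ (Fin p)) : Prop :=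
  ∀ x : EuclideanSpace ℝ (Fin p),
    Integrable (fun ω => ⟪X ω, x⟫ ^ 2) μ ∧ ∫ ω, ⟪X ω, x⟫ ^ 2 ∂μ = ‖x‖ ^ 2

/-- `(4, 2, γ)`-hypercontractivity: `E[(uᵀ x)⁴] ≤ γ E[(uᵀ x)²]²` for every `x`, where the
fourth moment is finite (on a probability space the second moment then is finite too). -/
def IsHypercontractive42 {Ω : Type*} [MeasurableSpace Ω] {p : ℕ} (μ : Measure Ω) (γ : ℝ)
    (X : Ω → EuclideanSpace ℝ (Fin p)) : Prop :=
  ∀ x : EuclideanSpace ℝ (Fin p),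
    Integrable (fun ω => ⟪X ω, x⟫ ^ 4) μ ∧
      ∫ ω, ⟪X ω, x⟫ ^ 4 ∂μ ≤ γ * (∫ ω, ⟪X ω, x⟫ ^ 2 ∂μ) ^ 2

/-- Zero third moment marginals: `E[(uᵀ x)³] = 0` for every `x` (the expectation being that
of an integrable variable). -/
def HasZeroThirdMomentMarginals {Ω : Type*} [MeasurableSpace Ω] {p : ℕ} (μ : Measure Ω)
    (X : Ω → EuclideanSpace ℝ (Fin p)) : Prop :=
  ∀ x : EuclideanSpace ℝ (Fin p),
    Integrable (fun ω => ⟪X ω, x⟫ ^ 3) μ ∧ ∫ ω, ⟪X ω, x⟫ ^ 3 ∂μ = 0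

/-- The distributional assumption on the inputs: an independent sequence of `p`-dimensional random
vectors (not necessarily identically distributed), each of them zero-mean, isotropic,
`(4, 2, γ)`-hypercontractive with the same `γ > 1`, and with zero third moment marginals. -/
structure InputAssumption {Ω : Type*} [MeasurableSpace Ω] {p : ℕ} (μ : Measure Ω) (γ : ℝ)
    (u : ℕ → Ω → EuclideanSpace ℝ (Fin p)) : Prop where
  one_lt : 1 < γ
  measurable : ∀ t, Measurable (u t)
  indep : iIndepFun u μ
  zero_mean : ∀ t, IsZeroMean μ (u t)
  isotropic : ∀ t, IsIsotropic μ (u t)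
  hypercontractive : ∀ t, IsHypercontractive42 μ γ (u t)
  zero_third : ∀ t, HasZeroThirdMomentMarginals μ (u t)

/-- The extended input `ū = (1, u)`, a vector with `p + 1` entries. -/
def ubar {p : ℕ} (v : EuclideanSpace ℝ (Fin p)) : Fin (p + 1) → ℝ :=
  Fin.cons 1 (fun i => v i)

/-- The index set of the entries of `ũ_t`. The left summand indexes the block `u_t`. In the right
summand, `⟨i, (a, b)⟩` with `i : Fin L` indexes the entries of the block
`ū_{t-1} ⊗ ⋯ ⊗ ū_{t-i} ⊗ u_{t-(i+1)}`: the `i` indices `a 0, …, a (i-1)` for the factors `ū`,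
and the index `b` for the last factor. -/
abbrev CovIndex (p L : ℕ) : Type :=
  Fin p ⊕ (Σ i : Fin L, (Fin (i : ℕ) → Fin (p + 1)) × Fin p)

/-- The covariate vector `ũ_t` built from an input sequence `u`, stacking `u_t`, `u_{t-1}`,
`ū_{t-1} ⊗ u_{t-2}`, …, `ū_{t-1} ⊗ ⋯ ⊗ ū_{t-(L-1)} ⊗ u_{t-L}`. It is meant for `t ≥ L`. -/
def utilde {p : ℕ} (L : ℕ) (u : ℕ → EuclideanSpace ℝ (Fin p)) (t : ℕ) : CovIndex p L → ℝ
  | Sum.inl b => u t b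
  | Sum.inr ⟨i, (a, b)⟩ =>
      (∏ l : Fin (i : ℕ), ubar (u (t - ((l : ℕ) + 1))) (a l)) * u (t - ((i : ℕ) + 1)) b

/-- The design matrix `Ũ`, with rows `ũ_tᵀ` for `t = L, …, T`. -/
def designMatrix {p : ℕ} (L T : ℕ) (u : ℕ → EuclideanSpace ℝ (Fin p)) :
    Matrix (Finset.Icc L T) (CovIndex p L) ℝ :=
  Matrix.of fun t => utilde L u (t : ℕ)

/-- The smallest eigenvalue of a real symmetric matrix (of positive size). -/
noncomputable def lambdaMin {ι : Type*} [Fintype ι] [DecidableEq ι] (A : Matrix ι ι ℝ) : ℝ :=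
  sInf (spectrum ℝ A)

/-! Up to the order of entries, the covariate at time t is a subvector of the full tensor product of
the L+1 independent extended inputs from times t, …, t-L: a missing factor is filled by the entry 1.
Its linear forms therefore inherit moments from the tensor product: isotropy gives second moment
‖x‖², and induction over the factors gives fourth moment at most K‖x‖⁴ with K = (3∨γ)^(L+1).

For a nonnegative variable, two moments control the lower tail: `lintegral_exp_neg_le` bounds the
Laplace transform of (ũᵀx)². Covariates at times congruent mod L+1 use disjoint inputs, so Hölder
over the L+1 residue classes (`lintegral_prod_rpow_le_of_window`) and Chernoff give, for fixed x and
n = T-L+1, P(∑(ũᵀx)² < n‖x‖²/2) ≤ exp(-n/(8K(L+1))).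

Uniformity over the sphere comes from a cubic grid of mesh about δ/(12d), d being the dimension of
ũ. Rounding is absorbed by the trace of the Gram matrix, for which Markov's inequality suffices
(`gramForm_ge_of_grid`). The grid has only (O(d/δ))^d points, which the sample size pays for. -/

theorem measurable_ubar {p : ℕ} (a : Fin (p + 1)) :
    Measurable fun v : EuclideanSpace ℝ (Fin p) => ubar v a := by
  refine Fin.cases ?_ (fun i => ?_) a
  · simp [ubar]
  · simp only [ubar, Fin.cons_succ]
    fun_prop

theorem sum_ubar_mul {p : ℕ} (v : EuclideanSpace ℝ (Fin p)) (g : Fin (p + 1) → ℝ) :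
    ∑ a, ubar v a * g a = g 0 + ⟪v, WithLp.toLp 2 fun i => g (Fin.succ i)⟫ := by
  rw [Fin.sum_univ_succ]
  simp [ubar, PiLp.inner_apply, mul_comm]

/-! ### Moments of one extended input -/

section SingleVector

variable {Ω : Type*} [MeasurableSpace Ω] {p : ℕ} {μ : Measure Ω}
  {X : Ω → EuclideanSpace ℝ (Fin p)}

theorem IsZeroMean.integral_inner_eq_zero (h : IsZeroMean μ X) (x : EuclideanSpace ℝ (Fin p)) :
    Integrable (fun ω => ⟪X ω, x⟫) μ ∧ ∫ ω, ⟪X ω, x⟫ ∂μ = 0 := by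
  refine ⟨h.1.inner_const x, ?_⟩
  have := integral_inner (𝕜 := ℝ) h.1 x
  rw [h.2, inner_zero_right] at this
  rw [← this]
  simp only [real_inner_comm]

theorem norm_sq_add_eq_sum {p : ℕ} (g : Fin (p + 1) → ℝ) :
    ∑ a, g a ^ 2 = g 0 ^ 2 + ‖WithLp.toLp 2 fun i : Fin p => g (Fin.succ i)‖ ^ 2 := by
  rw [Fin.sum_univ_succ, EuclideanSpace.real_norm_sq_eq]

theorem lintegral_sum_ubar_mul_sq [IsProbabilityMeasure μ] (h1 : IsZeroMean μ X) (h2 : IsIsotropic μ X)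
    (g : Fin (p + 1) → ℝ) :
    ∫⁻ ω, ENNReal.ofReal ((∑ a, ubar (X ω) a * g a) ^ 2) ∂μ
      = ENNReal.ofReal (∑ a, g a ^ 2) := by
  set x : EuclideanSpace ℝ (Fin p) := WithLp.toLp 2 fun i => g (Fin.succ i) with hx
  obtain ⟨i1, e1⟩ := h1.integral_inner_eq_zero x
  obtain ⟨i2, e2⟩ := h2 x
  have key : ∀ ω, (∑ a, ubar (X ω) a * g a) ^ 2
      = g 0 ^ 2 + (2 * g 0) * ⟪X ω, x⟫ + ⟪X ω, x⟫ ^ 2 := fun ω => by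
    rw [sum_ubar_mul]; ring
  have j1 : Integrable (fun ω => g 0 ^ 2 + (2 * g 0) * ⟪X ω, x⟫) μ :=
    (integrable_const _).add (i1.const_mul _)
  have int : Integrable (fun ω => g 0 ^ 2 + (2 * g 0) * ⟪X ω, x⟫ + ⟪X ω, x⟫ ^ 2) μ := j1.add i2
  simp_rw [key]
  rw [← ofReal_integral_eq_lintegral_ofReal int]
  · rw [integral_add j1 i2,
      integral_add (integrable_const _) (i1.const_mul _), integral_const_mul, e1, e2,
      norm_sq_add_eq_sum, ← hx]
    simp
  · exact Filter.Eventually.of_forall fun ω => by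
      simp only [Pi.zero_apply, ← key]; positivity

/-- With a the constant coefficient, expanding (a + ⟪X, x⟫)⁴ kills the odd terms, by zero mean and
zero third moments. What is left is at most a⁴ + 6a²‖x‖² + γ‖x‖⁴; the middle coefficient 6 = 2·3 is
where the 3 in 3∨γ comes from. -/
theorem lintegral_sum_ubar_mul_pow_four_le [IsProbabilityMeasure μ] {γ : ℝ} (h1 : IsZeroMean μ X) (h2 : IsIsotropic μ X)
    (h3 : HasZeroThirdMomentMarginals μ X) (h4 : IsHypercontractive42 μ γ X)
    (g : Fin (p + 1) → ℝ) :
    ∫⁻ ω, ENNReal.ofReal ((∑ a, ubar (X ω) a * g a) ^ 4) ∂μ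
      ≤ ENNReal.ofReal (max 3 γ * (∑ a, g a ^ 2) ^ 2) := by
  set x : EuclideanSpace ℝ (Fin p) := WithLp.toLp 2 fun i => g (Fin.succ i) with hx
  obtain ⟨i1, e1⟩ := h1.integral_inner_eq_zero x
  obtain ⟨i2, e2⟩ := h2 x
  obtain ⟨i3, e3⟩ := h3 x
  obtain ⟨i4, e4⟩ := h4 x
  have key : ∀ ω, (∑ a, ubar (X ω) a * g a) ^ 4
      = g 0 ^ 4 + (4 * g 0 ^ 3) * ⟪X ω, x⟫ + (6 * g 0 ^ 2) * ⟪X ω, x⟫ ^ 2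
        + (4 * g 0) * ⟪X ω, x⟫ ^ 3 + ⟪X ω, x⟫ ^ 4 := fun ω => by
    rw [sum_ubar_mul]; ring
  have j1 : Integrable (fun ω => g 0 ^ 4 + (4 * g 0 ^ 3) * ⟪X ω, x⟫) μ :=
    (integrable_const _).add (i1.const_mul _)
  have j2 : Integrable (fun ω => g 0 ^ 4 + (4 * g 0 ^ 3) * ⟪X ω, x⟫
      + (6 * g 0 ^ 2) * ⟪X ω, x⟫ ^ 2) μ := j1.add (i2.const_mul _)
  have j3 : Integrable (fun ω => g 0 ^ 4 + (4 * g 0 ^ 3) * ⟪X ω, x⟫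
      + (6 * g 0 ^ 2) * ⟪X ω, x⟫ ^ 2 + (4 * g 0) * ⟪X ω, x⟫ ^ 3) μ := j2.add (i3.const_mul _)
  have j4 : Integrable (fun ω => g 0 ^ 4 + (4 * g 0 ^ 3) * ⟪X ω, x⟫
      + (6 * g 0 ^ 2) * ⟪X ω, x⟫ ^ 2 + (4 * g 0) * ⟪X ω, x⟫ ^ 3 + ⟪X ω, x⟫ ^ 4) μ := j3.add i4
  simp_rw [key]
  rw [← ofReal_integral_eq_lintegral_ofReal j4]
  · apply ENNReal.ofReal_le_ofReal
    rw [integral_add j3 i4, integral_add j2 (i3.const_mul _), integral_add j1 (i2.const_mul _),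
      integral_add (integrable_const _) (i1.const_mul _), integral_const_mul, integral_const_mul,
      integral_const_mul, e1, e2, e3, norm_sq_add_eq_sum, ← hx]
    rw [e2] at e4
    simp only [integral_const, probReal_univ, one_smul, mul_zero, add_zero]
    have m3 : (3 : ℝ) ≤ max 3 γ := le_max_left _ _
    have m4 : γ ≤ max 3 γ := le_max_right _ _
    nlinarith [mul_nonneg (sub_nonneg.2 m3) (mul_nonneg (sq_nonneg (g 0)) (sq_nonneg ‖x‖)),
      mul_nonneg (sub_nonneg.2 m4) (sq_nonneg (‖x‖ ^ 2)),
      mul_nonneg (sub_nonneg.2 m3) (sq_nonneg (g 0 ^ 2)), sq_nonneg (g 0 ^ 2)]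
  · exact Filter.Eventually.of_forall fun ω => by
      simp only [Pi.zero_apply, ← key]; positivity

end SingleVector

/-! ### Moments of tensor products of independent extended inputs -/

section Tensor

/-- The entries of the tensor product `ū_0 ⊗ ⋯ ⊗ ū_{k-1}` of the extended inputs. -/
noncomputable def ubarTensor {p k : ℕ} (v : Fin k → EuclideanSpace ℝ (Fin p))
    (a : Fin k → Fin (p + 1)) : ℝ :=
  ∏ l, ubar (v l) (a l)

theorem measurable_sum_ubarTensor_mul {p k : ℕ} (y : (Fin k → Fin (p + 1)) → ℝ) :
    Measurable fun v : Fin k → EuclideanSpace ℝ (Fin p) => ∑ a, ubarTensor v a * y a := by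
  unfold ubarTensor
  exact Finset.measurable_sum _ fun a _ => (Finset.measurable_prod _ fun l _ =>
    (measurable_ubar (a l)).comp (measurable_pi_apply l)).mul_const _

theorem sum_fin_succ_fun {p k : ℕ} {M : Type*} [AddCommMonoid M]
    (f : (Fin (k + 1) → Fin (p + 1)) → M) :
    ∑ a, f a = ∑ b : Fin (p + 1), ∑ a : Fin k → Fin (p + 1), f (Fin.cons b a) := by
  rw [← Fintype.sum_prod_type']
  exact (Fintype.sum_equiv (Fin.consEquiv fun _ => Fin (p + 1)) _ _ fun x => rfl).symm

theorem sum_ubarTensor_mul_succ {p k : ℕ} (v : Fin (k + 1) → EuclideanSpace ℝ (Fin p))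
    (y : (Fin (k + 1) → Fin (p + 1)) → ℝ) :
    ∑ a, ubarTensor v a * y a
      = ∑ b, ubar (v 0) b * ∑ a, ubarTensor (fun l => v (Fin.succ l)) a * y (Fin.cons b a) := by
  rw [sum_fin_succ_fun]
  refine Finset.sum_congr rfl fun b _ => ?_
  rw [Finset.mul_sum]
  refine Finset.sum_congr rfl fun a _ => ?_
  simp [ubarTensor, Fin.prod_univ_succ, mul_assoc]

theorem lintegral_pi_succ {E : Type*} [MeasurableSpace E] {k : ℕ} (ν : Fin (k + 1) → Measure E)
    [∀ l, SigmaFinite (ν l)] {f : E → (Fin k → E) → ENNReal}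
    (hf : Measurable fun z : E × (Fin k → E) => f z.1 z.2) :
    ∫⁻ v, f (v 0) (fun l => v (Fin.succ l)) ∂Measure.pi ν
      = ∫⁻ w, ∫⁻ x, f x w ∂ν 0 ∂Measure.pi fun l => ν (Fin.succ l) := by
  have h := measurePreserving_piFinSuccAbove ν 0
  rw [← lintegral_prod_symm' _ hf]
  exact h.lintegral_comp hf

/-- Weighted Cauchy–Schwarz for a finite sum of nonnegative functions. -/
theorem lintegral_sum_sq_le {α ι : Type*} [MeasurableSpace α] {μ : Measure α} (s : Finset ι)
    {G : ι → α → ℝ} (hG : ∀ i ∈ s, Measurable (G i)) {q : ι → ℝ} (hq : ∀ i ∈ s, 0 ≤ q i)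
    (hz : ∀ i ∈ s, q i = 0 → ∀ x, G i x = 0) {M : ℝ} (hM : 0 ≤ M)
    (h4 : ∀ i ∈ s, ∫⁻ x, ENNReal.ofReal (G i x ^ 4) ∂μ ≤ ENNReal.ofReal (M * q i ^ 2)) :
    ∫⁻ x, ENNReal.ofReal ((∑ i ∈ s, G i x ^ 2) ^ 2) ∂μ
      ≤ ENNReal.ofReal (M * (∑ i ∈ s, q i) ^ 2) := by
  have hQ : 0 ≤ ∑ i ∈ s, q i := Finset.sum_nonneg hq
  have hpt : ∀ x, ENNReal.ofReal ((∑ i ∈ s, G i x ^ 2) ^ 2)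
      ≤ ENNReal.ofReal (∑ i ∈ s, q i) *
        ∑ i ∈ s, ENNReal.ofReal (q i)⁻¹ * ENNReal.ofReal (G i x ^ 4) := fun x => by
    -- Cauchy–Schwarz with weights `q i`; terms with `q i = 0` vanish by `hz`, so the convention 0⁻¹
    -- = 0 is harmless.
    have : (∑ i ∈ s, G i x ^ 2) ^ 2 ≤ (∑ i ∈ s, q i) * ∑ i ∈ s, (q i)⁻¹ * G i x ^ 4 := by
      refine Finset.sum_sq_le_sum_mul_sum_of_sq_le_mul s hq
        (fun i hi => mul_nonneg (inv_nonneg.2 (hq i hi)) (by positivity)) fun i hi => ?_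
      rcases eq_or_ne (q i) 0 with h | h
      · simp [h, hz i hi h x]
      · apply le_of_eq; field_simp
    refine (ENNReal.ofReal_le_ofReal this).trans ?_
    rw [ENNReal.ofReal_mul hQ, ENNReal.ofReal_sum_of_nonneg
      fun i hi => mul_nonneg (inv_nonneg.2 (hq i hi)) (by positivity)]
    refine mul_le_mul_right (Finset.sum_le_sum fun i hi => ?_) _
    rw [ENNReal.ofReal_mul (inv_nonneg.2 (hq i hi))]
  refine (lintegral_mono hpt).trans ?_
  have hmeas : ∀ i ∈ s, Measurable fun x => ENNReal.ofReal (G i x ^ 4) := fun i hi =>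
    ((hG i hi).pow_const 4).ennreal_ofReal
  rw [lintegral_const_mul _ (Finset.measurable_sum _ fun i hi => (hmeas i hi).const_mul _),
    lintegral_finsetSum _ fun i hi => (hmeas i hi).const_mul _]
  have : ∑ i ∈ s, ∫⁻ x, ENNReal.ofReal (q i)⁻¹ * ENNReal.ofReal (G i x ^ 4) ∂μ
      ≤ ∑ i ∈ s, ENNReal.ofReal (M * q i) := by
    refine Finset.sum_le_sum fun i hi => ?_
    rw [lintegral_const_mul _ (hmeas i hi)]
    refine (mul_le_mul_right (h4 i hi) _).trans ?_
    rw [← ENNReal.ofReal_mul (inv_nonneg.2 (hq i hi))]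
    apply ENNReal.ofReal_le_ofReal
    rcases eq_or_ne (q i) 0 with h | h
    · simp [h]
    · apply le_of_eq; field_simp
  refine (mul_le_mul_right this _).trans ?_
  rw [← ENNReal.ofReal_sum_of_nonneg fun i hi => mul_nonneg hM (hq i hi),
    ← ENNReal.ofReal_mul hQ, ← Finset.mul_sum]
  apply ENNReal.ofReal_le_ofReal
  apply le_of_eq; ring

variable {p : ℕ}

theorem lintegral_sum_ubarTensor_mul_sq {k : ℕ}
    (ν : Fin k → Measure (EuclideanSpace ℝ (Fin p))) [∀ l, IsProbabilityMeasure (ν l)]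
    (h2 : ∀ l (g : Fin (p + 1) → ℝ), ∫⁻ v, ENNReal.ofReal ((∑ a, ubar v a * g a) ^ 2) ∂ν l
      = ENNReal.ofReal (∑ a, g a ^ 2))
    (y : (Fin k → Fin (p + 1)) → ℝ) :
    ∫⁻ v, ENNReal.ofReal ((∑ a, ubarTensor v a * y a) ^ 2) ∂Measure.pi ν
      = ENNReal.ofReal (∑ a, y a ^ 2) := by
  induction k with
  | zero => simp [ubarTensor]
  | succ k ih =>
    simp_rw [sum_ubarTensor_mul_succ]
    rw [lintegral_pi_succ ν (f := fun x w => ENNReal.ofReal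
      ((∑ b, ubar x b * ∑ a, ubarTensor w a * y (Fin.cons b a)) ^ 2))]
    · simp_rw [h2]
      simp_rw [ENNReal.ofReal_sum_of_nonneg (fun b _ => sq_nonneg
        (∑ a, ubarTensor (_ : Fin k → EuclideanSpace ℝ (Fin p)) a * y (Fin.cons b a)))]
      rw [lintegral_finsetSum _ fun b _ =>
        ((measurable_sum_ubarTensor_mul _).pow_const 2).ennreal_ofReal, sum_fin_succ_fun,
        ENNReal.ofReal_sum_of_nonneg fun b _ => Finset.sum_nonneg fun _ _ => sq_nonneg _]
      exact Finset.sum_congr rfl fun b _ => ih _ (fun l => h2 _) _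
    · exact ((Finset.measurable_sum _ fun b _ => ((measurable_ubar b).comp measurable_fst).mul
        ((measurable_sum_ubarTensor_mul _).comp measurable_snd)).pow_const 2).ennreal_ofReal

/-- With the other factors frozen, integrating out the first costs one κ and leaves the squared sum
of squares of the slice contractions. The induction hypothesis bounds the fourth moment of each
slice, and `lintegral_sum_sq_le` recombines them without loss. -/
theorem lintegral_sum_ubarTensor_mul_pow_four_le {k : ℕ} {κ : ℝ} (hκ : 0 ≤ κ)
    (ν : Fin k → Measure (EuclideanSpace ℝ (Fin p))) [∀ l, IsProbabilityMeasure (ν l)]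
    (h4 : ∀ l (g : Fin (p + 1) → ℝ), ∫⁻ v, ENNReal.ofReal ((∑ a, ubar v a * g a) ^ 4) ∂ν l
      ≤ ENNReal.ofReal (κ * (∑ a, g a ^ 2) ^ 2))
    (y : (Fin k → Fin (p + 1)) → ℝ) :
    ∫⁻ v, ENNReal.ofReal ((∑ a, ubarTensor v a * y a) ^ 4) ∂Measure.pi ν
      ≤ ENNReal.ofReal (κ ^ k * (∑ a, y a ^ 2) ^ 2) := by
  induction k with
  | zero => simp [ubarTensor, ← pow_mul]
  | succ k ih =>
    simp_rw [sum_ubarTensor_mul_succ]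
    rw [lintegral_pi_succ ν (f := fun x w => ENNReal.ofReal
      ((∑ b, ubar x b * ∑ a, ubarTensor w a * y (Fin.cons b a)) ^ 4))]
    · refine (lintegral_mono fun w => h4 0 _).trans ?_
      simp_rw [ENNReal.ofReal_mul hκ]
      rw [lintegral_const_mul, pow_succ', mul_assoc, ENNReal.ofReal_mul hκ]
      · refine mul_le_mul_right ?_ _
        rw [sum_fin_succ_fun]
        refine lintegral_sum_sq_le _ (fun b _ => measurable_sum_ubarTensor_mul _)
          (fun b _ => Finset.sum_nonneg fun _ _ => sq_nonneg _) ?_ (pow_nonneg hκ k)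
          fun b _ => ih _ (fun l => h4 _) _
        intro b _ hb w
        rw [Finset.sum_eq_zero_iff_of_nonneg fun _ _ => sq_nonneg _] at hb
        exact Finset.sum_eq_zero fun a ha => by simp [pow_eq_zero_iff (two_ne_zero) |>.1 (hb a ha)]
      · exact ((Finset.measurable_sum _ fun b _ =>
          ((measurable_sum_ubarTensor_mul _).pow_const 2)).pow_const 2).ennreal_ofReal
    · exact ((Finset.measurable_sum _ fun b _ => ((measurable_ubar b).comp measurable_fst).mul
        ((measurable_sum_ubarTensor_mul _).comp measurable_snd)).pow_const 4).ennreal_ofReal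

end Tensor

/-! ### The covariate as a subvector of the full tensor product -/

section Embedding

variable {p L : ℕ}

/-- The position of an entry of `ũ_t` in the full tensor product `ū_t ⊗ ⋯ ⊗ ū_{t-L}`. -/
def covIndexToTensor : CovIndex p L → Fin (L + 1) → Fin (p + 1)
  | Sum.inl b => Fin.cons (Fin.succ b) fun _ => 0
  | Sum.inr ⟨i, (a, b)⟩ =>
      Fin.cons 0 fun l : Fin L =>
        if h : (l : ℕ) < i then a ⟨l, h⟩ else if (l : ℕ) = i then Fin.succ b else 0

/-- The last nonzero position of the multi-index identifies the block: there stands the successor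
index of the final factor, and only zeros follow. -/
theorem covIndexToTensor_injective : Function.Injective (covIndexToTensor (p := p) (L := L)) := by
  have key : ∀ (i j : Fin L) (x : (Fin (i : ℕ) → Fin (p + 1)) × Fin p)
      (y : (Fin (j : ℕ) → Fin (p + 1)) × Fin p),
      covIndexToTensor (L := L) (Sum.inr ⟨i, x⟩) = covIndexToTensor (Sum.inr ⟨j, y⟩) →
      ¬ i < j := by
    rintro i j ⟨a, b⟩ ⟨a', b'⟩ h hij
    have h1 := congrFun h (Fin.succ j)
    have hij' : (i : ℕ) < j := hij
    simp only [covIndexToTensor, Fin.cons_succ, lt_irrefl, dif_neg, not_false_eq_true, if_true] at h1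
    rw [dif_neg (by omega), if_neg (by omega)] at h1
    exact Fin.succ_ne_zero _ h1.symm
  rintro (b | ⟨i, a, b⟩) (b' | ⟨j, a', b'⟩) h
  · have h1 := congrFun h 0
    simpa [covIndexToTensor] using h1
  · have h1 := congrFun h 0
    simp [covIndexToTensor] at h1
  · have h1 := congrFun h 0
    simp only [covIndexToTensor, Fin.cons_zero] at h1
    exact absurd h1.symm (Fin.succ_ne_zero _)
  · obtain rfl : i = j := le_antisymm (not_lt.1 (key j i _ _ h.symm)) (not_lt.1 (key i j _ _ h))
    have hb := congrFun h (Fin.succ i)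
    simp only [covIndexToTensor, Fin.cons_succ, lt_irrefl, dif_neg, not_false_eq_true, if_true] at hb
    have ha : a = a' := by
      funext l
      have h1 := congrFun h (Fin.succ (Fin.castLE i.2.le l))
      have hl : (l : ℕ) < i := l.2
      simp only [covIndexToTensor, Fin.cons_succ, Fin.val_castLE, dif_pos hl] at h1
      exact h1
    rw [ha, Fin.succ_inj.1 hb]

theorem card_covIndex_le : Fintype.card (CovIndex p L) ≤ (p + 1) ^ (L + 1) := by
  simpa using Fintype.card_le_of_injective _ (covIndexToTensor_injective (p := p) (L := L))

/-- Index 0 selects the entry 1 of an extended input, so the padding positions contribute trivial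
factors. -/
theorem utilde_eq_ubarTensor (u : ℕ → EuclideanSpace ℝ (Fin p)) (t : ℕ) (c : CovIndex p L) :
    utilde L u t c
      = ubarTensor (fun l : Fin (L + 1) => u (t - (l : ℕ))) (covIndexToTensor c) := by
  rcases c with b | ⟨i, a, b⟩
  · simp [utilde, ubarTensor, covIndexToTensor, Fin.prod_univ_succ, ubar]
  · simp only [utilde, ubarTensor, covIndexToTensor, Fin.prod_univ_succ, Fin.cons_zero,
      Fin.cons_succ]
    have h0 : ubar (u (t - ((0 : Fin (L + 1)) : ℕ))) 0 = 1 := rfl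
    rw [h0, one_mul]
    obtain ⟨m, hm⟩ : ∃ m, L = (i : ℕ) + (1 + m) := ⟨L - i - 1, by omega⟩
    have hprod : ∀ f : ℕ → ℝ, ∏ l : Fin L, f l
        = (∏ l : Fin (i : ℕ), f l) * f i * ∏ l ∈ Finset.range m, f ((i : ℕ) + 1 + l) := fun f => by
      have hr : Finset.range L = Finset.range ((i : ℕ) + 1 + m) := congrArg _ (by omega)
      rw [Fin.prod_univ_eq_prod_range f L, hr, Finset.prod_range_add, Finset.prod_range_succ,
        Fin.prod_univ_eq_prod_range f (i : ℕ)]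
    set f : ℕ → ℝ := fun l => ubar (u (t - (l + 1)))
      (if h : l < i then a ⟨l, h⟩ else if l = i then Fin.succ b else 0) with hf
    have h1 := hprod f
    have h2 : ∀ l ∈ Finset.range m, f ((i : ℕ) + 1 + l) = 1 := fun l _ => by
      simp only [hf]
      rw [dif_neg (by omega), if_neg (by omega)]
      rfl
    have h3 : f i = u (t - ((i : ℕ) + 1)) b := by
      simp [hf, ubar]
    rw [Finset.prod_congr rfl h2, h3] at h1
    simp only [Finset.prod_const_one, mul_one] at h1
    refine Eq.trans ?_ h1.symm
    congr 1
    refine Finset.prod_congr rfl fun l _ => ?_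
    simp [hf]

theorem sum_ubarTensor_mul_extend (u : ℕ → EuclideanSpace ℝ (Fin p)) (t : ℕ)
    (x : CovIndex p L → ℝ) :
    ∑ a, ubarTensor (fun l : Fin (L + 1) => u (t - (l : ℕ))) a
        * Function.extend covIndexToTensor x 0 a = ∑ c, utilde L u t c * x c := by
  refine (Fintype.sum_of_injective _ covIndexToTensor_injective _ _ (fun a ha => ?_)
    fun c => ?_).symm
  · rw [Function.extend_apply' _ _ _ ha]; simp
  · rw [covIndexToTensor_injective.extend_apply, utilde_eq_ubarTensor]

theorem sum_extend_sq (x : CovIndex p L → ℝ) :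
    ∑ a, Function.extend covIndexToTensor x 0 a ^ 2 = ∑ c, x c ^ 2 := by
  refine (Fintype.sum_of_injective _ covIndexToTensor_injective _ _ (fun a ha => ?_)
    fun c => ?_).symm
  · rw [Function.extend_apply' _ _ _ ha]; simp
  · rw [covIndexToTensor_injective.extend_apply]

end Embedding

theorem measurable_covariate_dot {Ω : Type*} {m : MeasurableSpace Ω} {p L : ℕ}
    {u : ℕ → Ω → EuclideanSpace ℝ (Fin p)} (x : CovIndex p L → ℝ) (t : ℕ)
    (hu : ∀ i ∈ Set.Icc (t - L) t, Measurable (u i)) :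
    Measurable fun ω => ∑ c, utilde L (fun s => u s ω) t c * x c := by
  simp_rw [← sum_ubarTensor_mul_extend]
  refine (measurable_sum_ubarTensor_mul _).comp (measurable_pi_lambda _ fun l => hu _ ?_)
  exact ⟨by omega, by omega⟩

/-! ### Second and fourth moments of the covariate -/

section Covariate

variable {Ω : Type*} [MeasurableSpace Ω] {p L : ℕ} {μ : Measure Ω} {γ : ℝ}
  {u : ℕ → Ω → EuclideanSpace ℝ (Fin p)}

theorem InputAssumption.map_window (h : InputAssumption μ γ u) {t : ℕ} (ht : L ≤ t) :
    μ.map (fun ω (l : Fin (L + 1)) => u (t - (l : ℕ)) ω)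
      = Measure.pi fun l : Fin (L + 1) => μ.map (u (t - (l : ℕ))) := by
  -- `L ≤ t` keeps the truncated subtraction from identifying two times.
  have hinj : Function.Injective fun l : Fin (L + 1) => t - (l : ℕ) := fun a b hab => by
    simp only at hab
    ext; omega
  exact iIndepFun.map_fun_eq_pi_map (fun l => (h.measurable _).aemeasurable)
    (h.indep.precomp hinj)

theorem InputAssumption.lintegral_covariate_sq [IsProbabilityMeasure μ]
    (h : InputAssumption μ γ u) {t : ℕ} (ht : L ≤ t) (x : CovIndex p L → ℝ) :
    ∫⁻ ω, ENNReal.ofReal ((∑ c, utilde L (fun s => u s ω) t c * x c) ^ 2) ∂μ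
      = ENNReal.ofReal (∑ c, x c ^ 2) := by
  have hprob : ∀ l : Fin (L + 1), IsProbabilityMeasure (μ.map (u (t - (l : ℕ)))) := fun l =>
    Measure.isProbabilityMeasure_map (h.measurable _).aemeasurable
  have := lintegral_sum_ubarTensor_mul_sq (fun l : Fin (L + 1) => μ.map (u (t - (l : ℕ))))
    (fun l g => by
      rw [lintegral_map _ (h.measurable _)]
      · exact lintegral_sum_ubar_mul_sq (h.zero_mean _) (h.isotropic _) g
      · exact ((Finset.measurable_sum _ fun b _ =>
          (measurable_ubar b).mul_const _).pow_const 2).ennreal_ofReal)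
    (Function.extend covIndexToTensor x 0)
  rw [← h.map_window ht, lintegral_map, sum_extend_sq] at this
  · simpa only [← sum_ubarTensor_mul_extend] using this
  · exact ((measurable_sum_ubarTensor_mul _).pow_const 2).ennreal_ofReal
  · exact measurable_pi_lambda _ fun l => h.measurable _

theorem InputAssumption.lintegral_covariate_pow_four_le [IsProbabilityMeasure μ]
    (h : InputAssumption μ γ u) {t : ℕ} (ht : L ≤ t) (x : CovIndex p L → ℝ) :
    ∫⁻ ω, ENNReal.ofReal ((∑ c, utilde L (fun s => u s ω) t c * x c) ^ 4) ∂μ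
      ≤ ENNReal.ofReal (max 3 γ ^ (L + 1) * (∑ c, x c ^ 2) ^ 2) := by
  have hprob : ∀ l : Fin (L + 1), IsProbabilityMeasure (μ.map (u (t - (l : ℕ)))) := fun l =>
    Measure.isProbabilityMeasure_map (h.measurable _).aemeasurable
  have hκ : (0 : ℝ) ≤ max 3 γ := le_max_of_le_left (by norm_num)
  have := lintegral_sum_ubarTensor_mul_pow_four_le hκ
    (fun l : Fin (L + 1) => μ.map (u (t - (l : ℕ))))
    (fun l g => by
      rw [lintegral_map _ (h.measurable _)]
      · exact lintegral_sum_ubar_mul_pow_four_le (h.zero_mean _) (h.isotropic _) (h.zero_third _)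
          (h.hypercontractive _) g
      · exact ((Finset.measurable_sum _ fun b _ =>
          (measurable_ubar b).mul_const _).pow_const 4).ennreal_ofReal)
    (Function.extend covIndexToTensor x 0)
  rw [← h.map_window ht, lintegral_map, sum_extend_sq] at this
  · simpa only [← sum_ubarTensor_mul_extend] using this
  · exact ((measurable_sum_ubarTensor_mul _).pow_const 4).ennreal_ofReal
  · exact measurable_pi_lambda _ fun l => h.measurable _

end Covariate

/-! ### Laplace transforms and window dependence -/

section LowerTail

variable {Ω : Type*} {mΩ : MeasurableSpace Ω} {μ : Measure Ω}

/-- Multiply by exp z ≥ 1 + z + z²/2 and use (1 - z + z²/2)(1 + z + z²/2) = 1 + z⁴/4. -/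
theorem Real.exp_neg_le_quadratic {z : ℝ} (hz : 0 ≤ z) :
    Real.exp (-z) ≤ 1 - z + z ^ 2 / 2 := by
  rw [Real.exp_neg, inv_le_iff_one_le_mul₀ (Real.exp_pos z)]
  have h1 := Real.quadratic_le_exp_of_nonneg hz
  have h2 : 0 ≤ 1 - z + z ^ 2 / 2 := by nlinarith [sq_nonneg (z - 1)]
  nlinarith [mul_le_mul_of_nonneg_left h1 h2, sq_nonneg (z ^ 2)]

theorem lintegral_exp_neg_le [IsProbabilityMeasure μ] {W : Ω → ℝ} (hW : Measurable W)
    (hW0 : ∀ ω, 0 ≤ W ω) {q h : ℝ} (hq : 0 < q) (hh : 0 < h)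
    (h1 : ∫⁻ ω, ENNReal.ofReal (W ω) ∂μ = ENNReal.ofReal q)
    (h2 : ∫⁻ ω, ENNReal.ofReal (W ω ^ 2) ∂μ ≤ ENNReal.ofReal (h * q ^ 2)) :
    ∫⁻ ω, ENNReal.ofReal (Real.exp (-(W ω / (2 * h * q)))) ∂μ
      ≤ ENNReal.ofReal (Real.exp (-(3 / (8 * h)))) := by
  -- With this s, 1 - sq + s²hq²/2 = 1 - 1/(2h) + 1/(8h) = 1 - 3/(8h).
  set s : ℝ := (2 * h * q)⁻¹ with hs
  have hs0 : 0 ≤ s := by positivity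
  -- The linear term is moved to the left because subtraction in `ENNReal` is truncated.
  have hpt : ∀ ω, ENNReal.ofReal (Real.exp (-(W ω / (2 * h * q))))
      + ENNReal.ofReal s * ENNReal.ofReal (W ω)
      ≤ 1 + ENNReal.ofReal (s ^ 2 / 2) * ENNReal.ofReal (W ω ^ 2) := fun ω => by
    rw [← ENNReal.ofReal_mul hs0, ← ENNReal.ofReal_mul (by positivity),
      ← ENNReal.ofReal_add (Real.exp_pos _).le (mul_nonneg hs0 (hW0 ω)), ← ENNReal.ofReal_one,
      ← ENNReal.ofReal_add zero_le_one (by positivity)]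
    apply ENNReal.ofReal_le_ofReal
    have := Real.exp_neg_le_quadratic (mul_nonneg hs0 (hW0 ω))
    rw [div_eq_inv_mul, ← hs]
    linarith [mul_pow s (W ω) 2]
  have hint := lintegral_mono (μ := μ) hpt
  have hm : Measurable fun ω => ENNReal.ofReal (W ω) := hW.ennreal_ofReal
  have hm2 : Measurable fun ω => ENNReal.ofReal (W ω ^ 2) := (hW.pow_const 2).ennreal_ofReal
  rw [lintegral_add_right _ (hm.const_mul _), lintegral_add_right _ (hm2.const_mul _),
    lintegral_const_mul _ hm, lintegral_const_mul _ hm2, h1, lintegral_const, measure_univ,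
    mul_one] at hint
  have hint2 := hint.trans (add_le_add_right (mul_le_mul_right h2 _) 1)
  rw [← ENNReal.ofReal_mul hs0, ← ENNReal.ofReal_mul (by positivity), ← ENNReal.ofReal_one,
    ← ENNReal.ofReal_add zero_le_one (by positivity)] at hint2
  have hint3 := ENNReal.le_sub_of_add_le_right ENNReal.ofReal_ne_top hint2
  rw [← ENNReal.ofReal_sub _ (by positivity)] at hint3
  refine hint3.trans (ENNReal.ofReal_le_ofReal ?_)
  have e : 1 + s ^ 2 / 2 * (h * q ^ 2) - s * q = -(3 / (8 * h)) + 1 := by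
    rw [hs]; field_simp; ring
  rw [e]
  exact Real.add_one_le_exp _

theorem lintegral_prod_eq_of_iIndep_disjoint {ι κ : Type*} {m : ι → MeasurableSpace Ω}
    (hm : ∀ i, m i ≤ mΩ) (hindep : iIndep m μ) (B : κ → Set ι) (s : Finset κ)
    (hB : (s : Set κ).PairwiseDisjoint B) {f : κ → Ω → ENNReal}
    (hf : ∀ k ∈ s, Measurable[⨆ i ∈ B k, m i] (f k)) :
    ∫⁻ ω, ∏ k ∈ s, f k ω ∂μ = ∏ k ∈ s, ∫⁻ ω, f k ω ∂μ := by
  classical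
  have : IsProbabilityMeasure μ := hindep.isProbabilityMeasure
  induction s using Finset.induction with
  | empty => simp
  | insert k s hk ih =>
    simp_rw [Finset.prod_insert hk]
    rw [← ih (hB.subset (by simp)) fun j hj => hf j (Finset.mem_insert_of_mem hj)]
    have hle : ∀ S : Set ι, ⨆ i ∈ S, m i ≤ mΩ := fun S => iSup₂_le fun i _ => hm i
    refine lintegral_mul_eq_lintegral_mul_lintegral_of_independent_measurableSpace (hle (B k))
      (hle (⋃ j ∈ s, B j)) (indep_iSup_of_disjoint hm hindep ?_)
      (hf k (Finset.mem_insert_self k s)) ?_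
    · rw [Set.disjoint_iUnion₂_right]
      intro j hj
      exact hB (by simp) (by simp [hj]) (by rintro rfl; exact hk hj)
    · refine Finset.measurable_prod _ fun j hj => (hf j (Finset.mem_insert_of_mem hj)).mono ?_ le_rfl
      exact biSup_mono fun i hi => Set.mem_biUnion (show j ∈ (s : Set κ) from hj) hi

/-- Hölder over the residue classes mod L+1 decouples the overlapping windows; within a class the
windows are disjoint and the integral factorizes. The price is the exponent 1/(L+1). -/
theorem lintegral_prod_rpow_le_of_window {m : ℕ → MeasurableSpace Ω}
    (hm : ∀ i, m i ≤ mΩ) (hindep : iIndep m μ) (L : ℕ) {s : Finset ℕ}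
    {f : ℕ → Ω → ENNReal} (hf : ∀ t ∈ s, Measurable[⨆ i ∈ Set.Icc (t - L) t, m i] (f t))
    {c : ENNReal} (hc : ∀ t ∈ s, ∫⁻ ω, f t ω ∂μ ≤ c) :
    ∫⁻ ω, ∏ t ∈ s, f t ω ^ ((L : ℝ) + 1)⁻¹ ∂μ ≤ (c ^ ((L : ℝ) + 1)⁻¹) ^ s.card := by
  set r : ℝ := ((L : ℝ) + 1)⁻¹ with hr
  have hr0 : 0 ≤ r := by positivity
  have hmaps : ∀ t ∈ s, t % (L + 1) ∈ Finset.range (L + 1) := fun t _ =>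
    Finset.mem_range.2 (Nat.mod_lt _ (Nat.succ_pos L))
  set S : ℕ → Finset ℕ := fun j => s.filter fun t => t % (L + 1) = j with hS
  have hfm : ∀ t ∈ s, Measurable (f t) := fun t ht =>
    (hf t ht).mono (iSup₂_le fun i _ => hm i) le_rfl
  have hprod : ∀ ω, ∏ t ∈ s, f t ω ^ r = ∏ j ∈ Finset.range (L + 1), (∏ t ∈ S j, f t ω) ^ r :=
    fun ω => by
      rw [← Finset.prod_fiberwise_of_maps_to hmaps]
      exact Finset.prod_congr rfl fun j _ => ENNReal.prod_rpow_of_nonneg hr0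
  simp_rw [hprod]
  refine (ENNReal.lintegral_prod_norm_pow_le (Finset.range (L + 1)) (fun j _ =>
    (Finset.measurable_prod _ fun t ht => hfm t (Finset.mem_filter.1 ht).1).aemeasurable)
    (p := fun _ => r) ?_ fun _ _ => hr0).trans ?_
  · simp only [Finset.sum_const, Finset.card_range, nsmul_eq_mul, hr]
    push_cast
    field_simp
  · have hblock : ∀ j ∈ Finset.range (L + 1),
        (∫⁻ ω, ∏ t ∈ S j, f t ω ∂μ) ^ r ≤ ∏ t ∈ S j, c ^ r := fun j _ => by
      rw [lintegral_prod_eq_of_iIndep_disjoint hm hindep (fun t => Set.Icc (t - L) t) (S j) ?_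
        fun t ht => hf t (Finset.mem_filter.1 ht).1, ENNReal.prod_rpow_of_nonneg hr0]
      · gcongr with t ht
        exact hc t (Finset.mem_filter.1 ht).1
      · have aux : ∀ a ∈ S j, ∀ b ∈ S j, a < b → a < b - L := fun a ha b hb hab => by
          have h1 := (Finset.mem_filter.1 ha).2
          have h2 := (Finset.mem_filter.1 hb).2
          have h3 := (Nat.modEq_iff_dvd' hab.le).1 (h1.trans h2.symm)
          have := Nat.le_of_dvd (by omega) h3
          omega
        intro a ha b hb hab
        rw [Function.onFun, Set.disjoint_left]
        rintro i ⟨h1, h2⟩ ⟨h3, h4⟩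
        rcases lt_or_gt_of_ne hab with h | h
        · have := aux a ha b hb h; omega
        · have := aux b hb a ha h; omega
    refine (Finset.prod_le_prod' hblock).trans ?_
    rw [Finset.prod_fiberwise_of_maps_to hmaps, Finset.prod_const]

end LowerTail

/-! ### Gram forms, smallest eigenvalues and discretization -/

section QuadraticForm

variable {ι : Type*}

/-- The quadratic form `∑ₜ (vₜᵀ x)²` of the Gram matrix `∑ₜ vₜ vₜᵀ`. -/
def gramForm [Fintype ι] (s : Finset ℕ) (v : ℕ → ι → ℝ) (x : ι → ℝ) : ℝ :=
  ∑ t ∈ s, (∑ c, v t c * x c) ^ 2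

theorem gramForm_nonneg [Fintype ι] (s : Finset ℕ) (v : ℕ → ι → ℝ) (x : ι → ℝ) : 0 ≤ gramForm s v x :=
  Finset.sum_nonneg fun _ _ => sq_nonneg _

theorem gramForm_le_trace_mul [Fintype ι] (s : Finset ℕ) (v : ℕ → ι → ℝ) (x : ι → ℝ) :
    gramForm s v x ≤ (∑ t ∈ s, ∑ c, v t c ^ 2) * ∑ c, x c ^ 2 := by
  rw [Finset.sum_mul]
  exact Finset.sum_le_sum fun t _ => Finset.sum_mul_sq_le_sq_mul_sq _ _ _

theorem sq_le_of_sub (a b : ℝ) : b ^ 2 ≤ 5 / 4 * a ^ 2 + 5 * (a - b) ^ 2 := by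
  nlinarith [sq_nonneg (5 * a - 4 * b)]

theorem gramForm_le_add_sub [Fintype ι] (s : Finset ℕ) (v : ℕ → ι → ℝ) (x w : ι → ℝ) :
    gramForm s v w ≤ 5 / 4 * gramForm s v x + 5 * gramForm s v (fun c => x c - w c) := by
  unfold gramForm
  rw [Finset.mul_sum, Finset.mul_sum, ← Finset.sum_add_distrib]
  refine Finset.sum_le_sum fun t _ => (sq_le_of_sub (∑ c, v t c * x c) _).trans_eq ?_
  simp only [mul_sub, Finset.sum_sub_distrib]

/-- Each eigenvalue is the value of the form at a unit eigenvector; nonemptiness of the index type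
keeps `sInf` away from the empty set. -/
theorem lambdaMin_gram_ge [Fintype ι] [DecidableEq ι] [Nonempty ι] (s : Finset ℕ) (v : ℕ → ι → ℝ) {b : ℝ}
    (h : ∀ x : ι → ℝ, ∑ c, x c ^ 2 = 1 → b ≤ gramForm s v x) :
    b ≤ lambdaMin (∑ t ∈ s, Matrix.vecMulVec (v t) (v t)) := by
  have hA : (∑ t ∈ s, Matrix.vecMulVec (v t) (v t)).IsHermitian := by
    ext i j
    simp [Matrix.sum_apply, Matrix.vecMulVec_apply, mul_comm]
  unfold lambdaMin
  rw [hA.spectrum_real_eq_range_eigenvalues]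
  refine le_csInf (Set.range_nonempty _) ?_
  rintro _ ⟨i, rfl⟩
  set x : ι → ℝ := fun c => hA.eigenvectorBasis i c with hx
  have hnorm : ∑ c, x c ^ 2 = 1 := by
    rw [← EuclideanSpace.real_norm_sq_eq, hA.eigenvectorBasis.orthonormal.1 i, one_pow]
  have hmul := hA.mulVec_eigenvectorBasis i
  have hdot : x ⬝ᵥ ((∑ t ∈ s, Matrix.vecMulVec (v t) (v t)) *ᵥ x) = hA.eigenvalues i := by
    have : (∑ t ∈ s, Matrix.vecMulVec (v t) (v t)) *ᵥ x = hA.eigenvalues i • x := hmul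
    rw [this, dotProduct_smul]
    simp only [dotProduct, ← sq, hnorm, smul_eq_mul, mul_one]
  refine (h x hnorm).trans_eq (Eq.trans ?_ hdot)
  rw [Matrix.sum_mulVec, dotProduct_sum]
  refine Finset.sum_congr rfl fun t _ => ?_
  rw [Matrix.vecMulVec_mulVec, dotProduct_smul]
  simp [dotProduct, sq, mul_comm]

/-- The points of the grid `{-1, -1 + 1/m, …, 1}^ι`. -/
noncomputable def gridPoint (m : ℕ) (z : ι → Fin (2 * m + 1)) : ι → ℝ :=
  fun c => ((z c : ℕ) : ℝ) / m - 1

theorem exists_gridPoint_sub_le {m : ℕ} (hm : 0 < m) {x : ι → ℝ} (hx : ∀ c, |x c| ≤ 1) :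
    ∃ z, ∀ c, |x c - gridPoint m z c| ≤ 1 / m := by
  have hm' : (0 : ℝ) < m := Nat.cast_pos.2 hm
  have h0 : ∀ c, 0 ≤ (x c + 1) * m := fun c =>
    mul_nonneg (by linarith [(abs_le.1 (hx c)).1]) hm'.le
  have hlt : ∀ c, ⌊(x c + 1) * m⌋₊ < 2 * m + 1 := fun c => by
    have h1 : (x c + 1) * m ≤ 2 * m :=
      mul_le_mul_of_nonneg_right (by linarith [(abs_le.1 (hx c)).2]) hm'.le
    have h2 := (Nat.floor_le (h0 c)).trans h1
    have h3 : ⌊(x c + 1) * m⌋₊ ≤ 2 * m := by exact_mod_cast h2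
    omega
  refine ⟨fun c => ⟨_, hlt c⟩, fun c => ?_⟩
  have e : x c - gridPoint m (fun c => ⟨_, hlt c⟩) c
      = ((x c + 1) * m - ⌊(x c + 1) * m⌋₊) / m := by
    simp only [gridPoint]; field_simp; ring
  rw [e, abs_div, abs_of_pos hm']
  gcongr
  rw [abs_le]
  constructor
  · linarith [Nat.floor_le (h0 c)]
  · linarith [Nat.lt_floor_add_one ((x c + 1) * m)]

/-- Round x to a grid point w. The crude trace bound 2dn/δ times the squared rounding error
δ²/(144d) is at most n/72, which is why the mesh must shrink with δ/d. -/
theorem gramForm_ge_of_grid [Fintype ι] {s : Finset ℕ} {v : ℕ → ι → ℝ} {δ : ℝ} (hδ : 0 < δ) (hδ1 : δ < 1)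
    {m : ℕ} (hd : 0 < Fintype.card ι) (hm : 12 * (Fintype.card ι : ℝ) / δ ≤ m)
    (htr : ∑ t ∈ s, ∑ c, v t c ^ 2 ≤ 2 * Fintype.card ι * s.card / δ)
    (hgrid : ∀ z, (s.card : ℝ) / 2 * ∑ c, gridPoint m z c ^ 2 ≤ gramForm s v (gridPoint m z))
    {x : ι → ℝ} (hx : ∑ c, x c ^ 2 = 1) :
    (s.card : ℝ) / 4 ≤ gramForm s v x := by
  set d : ℝ := (Fintype.card ι : ℝ) with hd'
  set n : ℝ := (s.card : ℝ) with hn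
  have hn0 : 0 ≤ n := Nat.cast_nonneg _
  have hd1 : 1 ≤ d := Nat.one_le_cast.2 hd
  have hmR : (0 : ℝ) < m := lt_of_lt_of_le (by positivity) hm
  obtain ⟨z, hz⟩ := exists_gridPoint_sub_le (Nat.cast_pos.1 hmR) (x := x) fun c => by
    rw [← sq_le_one_iff_abs_le_one, ← hx]
    exact Finset.single_le_sum (f := fun c => x c ^ 2) (fun _ _ => sq_nonneg _) (Finset.mem_univ c)
  set w := gridPoint m z with hw
  have he : ∑ c, (x c - w c) ^ 2 ≤ d * (1 / (m : ℝ)) ^ 2 := by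
    have : ∀ c ∈ Finset.univ, (x c - w c) ^ 2 ≤ (1 / (m : ℝ)) ^ 2 := fun c _ => by
      rw [← sq_abs]
      exact pow_le_pow_left₀ (abs_nonneg _) (hz c) 2
    simpa [hd'] using Finset.sum_le_sum this
  have hη : d * (1 / (m : ℝ)) ^ 2 ≤ δ ^ 2 / (144 * d) := by
    have h1 : 1 / (m : ℝ) ≤ δ / (12 * d) := by
      rw [div_le_div_iff₀ hmR (by positivity)]
      rw [div_le_iff₀ hδ] at hm
      linarith
    calc d * (1 / (m : ℝ)) ^ 2 ≤ d * (δ / (12 * d)) ^ 2 := by gcongr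
      _ = δ ^ 2 / (144 * d) := by field_simp; norm_num
  have he' : ∑ c, (x c - w c) ^ 2 ≤ δ ^ 2 / (144 * d) := he.trans hη
  have he1 : ∑ c, (x c - w c) ^ 2 ≤ 1 / 144 := he'.trans (by
    gcongr
    · nlinarith
    · linarith)
  have hQe : gramForm s v (fun c => x c - w c) ≤ n / 72 := by
    refine (gramForm_le_trace_mul s v _).trans ?_
    calc _ ≤ (2 * d * n / δ) * (δ ^ 2 / (144 * d)) := by gcongr
      _ = n * δ / 72 := by field_simp; ring
      _ ≤ n / 72 := by gcongr; nlinarith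
  have hxw : (1 : ℝ) ≤ 5 / 4 * ∑ c, w c ^ 2 + 5 * ∑ c, (x c - w c) ^ 2 := by
    rw [← hx, Finset.mul_sum, Finset.mul_sum, ← Finset.sum_add_distrib]
    refine Finset.sum_le_sum fun c _ => ?_
    have := sq_le_of_sub (w c) (x c)
    nlinarith
  have h1 := gramForm_le_add_sub s v x w
  have h2 := hgrid z
  have h3 : 139 / 180 ≤ ∑ c, w c ^ 2 := by linarith
  -- By `h1`, the form at x is at least (4/5)(139/360 - 5/72)n = (19/75)n, just above n/4.
  nlinarith [mul_le_mul_of_nonneg_left h3 hn0]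

end QuadraticForm

/-! ### Probability bounds -/

section Concentration

variable {Ω : Type*} [MeasurableSpace Ω] {p L : ℕ} {μ : Measure Ω}
  {γ : ℝ} {u : ℕ → Ω → EuclideanSpace ℝ (Fin p)}

theorem InputAssumption.measurable_covariate_dot (h : InputAssumption μ γ u)
    (x : CovIndex p L → ℝ) (t : ℕ) :
    Measurable fun ω => ∑ c, utilde L (fun s => u s ω) t c * x c :=
  _root_.measurable_covariate_dot x t fun i _ => h.measurable i

/-- Chernoff: after Hölder, the Laplace transform contributes exp(-3n/(8K(L+1))), and Markov at
level n‖x‖²/2 loses exp(n/(4K(L+1))), leaving the rate 1/(8K(L+1)). -/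
theorem InputAssumption.measure_gramForm_lt_le [IsProbabilityMeasure μ] (h : InputAssumption μ γ u) {s : Finset ℕ}
    (hs : ∀ t ∈ s, L ≤ t) (x : CovIndex p L → ℝ) :
    μ {ω | gramForm s (utilde L fun i => u i ω) x < s.card / 2 * ∑ c, x c ^ 2}
      ≤ ENNReal.ofReal (Real.exp (-(s.card / (8 * max 3 γ ^ (L + 1) * (L + 1))))) := by
  set K : ℝ := max 3 γ ^ (L + 1) with hK
  have hK0 : 0 < K := pow_pos (lt_max_of_lt_left (by norm_num)) _
  set q : ℝ := ∑ c, x c ^ 2 with hq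
  set n : ℝ := (s.card : ℝ) with hn
  set r : ℝ := ((L : ℝ) + 1)⁻¹ with hr
  have hr0 : 0 < r := by positivity
  have hq0 : 0 ≤ q := Finset.sum_nonneg fun _ _ => sq_nonneg _
  -- The grid contains the origin, for which the Laplace parameter 1/(2Kq) is unavailable; the event
  -- is then empty.
  rcases hq0.eq_or_lt with hq1 | hqpos
  · have : {ω | gramForm s (utilde L fun i => u i ω) x < n / 2 * q} = ∅ := by
      ext ω
      simp [← hq1, gramForm_nonneg]
    simp [this]
  set W : ℕ → Ω → ℝ := fun t ω => (∑ c, utilde L (fun i => u i ω) t c * x c) ^ 2 with hW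
  set f : ℕ → Ω → ENNReal := fun t ω => ENNReal.ofReal (Real.exp (-(W t ω / (2 * K * q)))) with hf
  have hWf : ∀ (m : MeasurableSpace Ω) (t : ℕ), Measurable[m] (W t) → Measurable[m] (f t) :=
    fun m t ht => (Real.measurable_exp.comp (ht.div_const _).neg).ennreal_ofReal
  have hWm : ∀ t, Measurable (W t) := fun t => (h.measurable_covariate_dot x t).pow_const 2
  have hint := lintegral_prod_rpow_le_of_window (μ := μ) (f := f) (s := s)
    (fun i => (h.measurable i).comap_le) h.indep.iIndep L
    (fun t _ => hWf _ t ((_root_.measurable_covariate_dot x t fun i hi =>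
      (comap_measurable (u i)).mono (le_biSup (fun i => MeasurableSpace.comap (u i) _) hi)
        le_rfl).pow_const 2))
    (fun t ht => lintegral_exp_neg_le (hWm t) (fun ω => sq_nonneg _) hqpos hK0
      (h.lintegral_covariate_sq (hs t ht) x) (by
        simpa only [hW, ← pow_mul] using h.lintegral_covariate_pow_four_le (hs t ht) x))
  have hprod : ∀ ω, ∏ t ∈ s, f t ω ^ r
      = ENNReal.ofReal (Real.exp (-(r * (∑ t ∈ s, W t ω) / (2 * K * q)))) := fun ω => by
    have : ∀ t ∈ s, f t ω ^ r = ENNReal.ofReal (Real.exp (-(r * W t ω / (2 * K * q)))) :=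
      fun t _ => by
        rw [hf, ENNReal.ofReal_rpow_of_pos (Real.exp_pos _), ← Real.exp_mul]
        ring_nf
    rw [Finset.prod_congr rfl this,
      ← ENNReal.ofReal_prod_of_nonneg fun _ _ => (Real.exp_pos _).le, ← Real.exp_sum,
      Finset.sum_neg_distrib, ← Finset.sum_div, ← Finset.mul_sum]
  simp_rw [← hr, hprod] at hint
  set F : Ω → ENNReal :=
    fun ω => ENNReal.ofReal (Real.exp (-(r * (∑ t ∈ s, W t ω) / (2 * K * q)))) with hF
  have hFm : Measurable F := (Real.measurable_exp.comp
    (((Finset.measurable_sum s fun t _ => hWm t).const_mul r).div_const _).neg).ennreal_ofReal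
  set ε : ℝ := Real.exp (-(n * r / (4 * K))) with hε
  have hε0 : 0 < ε := Real.exp_pos _
  have hsub : {ω | gramForm s (utilde L fun i => u i ω) x < n / 2 * q}
      ⊆ {ω | ENNReal.ofReal ε ≤ F ω} := fun ω hω => by
    have hω' : ∑ t ∈ s, W t ω < n / 2 * q := hω
    refine ENNReal.ofReal_le_ofReal (Real.exp_le_exp.2 (neg_le_neg ?_))
    rw [div_le_div_iff₀ (by positivity) (by positivity)]
    have := mul_le_mul_of_nonneg_left hω'.le (show 0 ≤ r * (4 * K) by positivity)
    linarith
  refine (measure_mono hsub).trans ((meas_ge_le_lintegral_div hFm.aemeasurable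
    (by simpa using hε0) ENNReal.ofReal_ne_top).trans ?_)
  refine (ENNReal.div_le_div_right hint _).trans ?_
  rw [ENNReal.ofReal_rpow_of_pos (Real.exp_pos _), ← Real.exp_mul,
    ← ENNReal.ofReal_pow (Real.exp_pos _).le, ← Real.exp_nat_mul,
    ← ENNReal.ofReal_div_of_pos hε0, hε, ← Real.exp_sub]
  refine ENNReal.ofReal_le_ofReal (Real.exp_le_exp.2 (le_of_eq ?_))
  rw [← hn, hr]
  field_simp
  ring

/-- Isotropy along coordinate vectors gives the trace expectation nd; the threshold is 2/δ times
that, so Markov yields δ/2. -/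
theorem InputAssumption.measure_trace_ge_le [IsProbabilityMeasure μ] (h : InputAssumption μ γ u) {s : Finset ℕ}
    (hs : ∀ t ∈ s, L ≤ t) (hne : 0 < s.card) (hp : 0 < Fintype.card (CovIndex p L)) {δ : ℝ}
    (hδ : 0 < δ) :
    μ {ω | 2 * Fintype.card (CovIndex p L) * s.card / δ
        ≤ ∑ t ∈ s, ∑ c, utilde L (fun i => u i ω) t c ^ 2} ≤ ENNReal.ofReal (δ / 2) := by
  set d : ℝ := (Fintype.card (CovIndex p L) : ℝ) with hd
  set n : ℝ := (s.card : ℝ) with hn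
  have hd0 : 0 < d := Nat.cast_pos.2 hp
  have hn0 : 0 < n := Nat.cast_pos.2 hne
  have hsingle : ∀ ω t (c : CovIndex p L), ∑ c', utilde L (fun i => u i ω) t c'
      * (Pi.single c 1 : CovIndex p L → ℝ) c' = utilde L (fun i => u i ω) t c := fun ω t c => by
    simp [Pi.single_apply]
  have hm : ∀ t (c : CovIndex p L), Measurable fun ω =>
      ENNReal.ofReal (utilde L (fun i => u i ω) t c ^ 2) := fun t c => by
    have := h.measurable_covariate_dot (Pi.single c 1 : CovIndex p L → ℝ) t
    simp_rw [hsingle] at this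
    exact (this.pow_const 2).ennreal_ofReal
  have hint : ∀ t ∈ s, ∀ c : CovIndex p L,
      ∫⁻ ω, ENNReal.ofReal (utilde L (fun i => u i ω) t c ^ 2) ∂μ = 1 := fun t ht c => by
    have := h.lintegral_covariate_sq (hs t ht) (Pi.single c 1 : CovIndex p L → ℝ)
    simp_rw [hsingle] at this
    simpa [Pi.single_apply, ite_pow] using this
  have hof : ∀ ω, ENNReal.ofReal (∑ t ∈ s, ∑ c, utilde L (fun i => u i ω) t c ^ 2)
      = ∑ t ∈ s, ∑ c, ENNReal.ofReal (utilde L (fun i => u i ω) t c ^ 2) := fun ω => by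
    rw [ENNReal.ofReal_sum_of_nonneg fun _ _ => Finset.sum_nonneg fun _ _ => sq_nonneg _]
    exact Finset.sum_congr rfl fun t _ => ENNReal.ofReal_sum_of_nonneg fun _ _ => sq_nonneg _
  set F : Ω → ENNReal := fun ω =>
    ∑ t ∈ s, ∑ c, ENNReal.ofReal (utilde L (fun i => u i ω) t c ^ 2) with hF
  have hFm : Measurable F :=
    Finset.measurable_sum _ fun t _ => Finset.measurable_sum _ fun c _ => hm t c
  have hFi : ∫⁻ ω, F ω ∂μ = ENNReal.ofReal (n * d) := by
    rw [hF, lintegral_finsetSum _ fun t _ => Finset.measurable_sum _ fun c _ => hm t c]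
    rw [Finset.sum_congr rfl fun t ht => (lintegral_finsetSum _ fun c _ => hm t c).trans
      (Finset.sum_congr rfl fun c _ => hint t ht c)]
    rw [ENNReal.ofReal_mul hn0.le, hn, hd, ENNReal.ofReal_natCast, ENNReal.ofReal_natCast]
    simp only [Finset.sum_const, nsmul_eq_mul, mul_one, Finset.card_univ]
  have hb : 0 < 2 * d * n / δ := by positivity
  refine (measure_mono (t := {ω | ENNReal.ofReal (2 * d * n / δ) ≤ F ω}) fun ω hω => ?_).trans
    ((meas_ge_le_lintegral_div hFm.aemeasurable (by simpa using hb)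
      ENNReal.ofReal_ne_top).trans ?_)
  · exact (ENNReal.ofReal_le_ofReal hω).trans_eq (hof ω)
  · rw [hFi, ← ENNReal.ofReal_div_of_pos hb]
    refine ENNReal.ofReal_le_ofReal (le_of_eq ?_)
    field_simp

theorem InputAssumption.persistence_of_excitation [IsProbabilityMeasure μ] (h : InputAssumption μ γ u) {s : Finset ℕ}
    (hs : ∀ t ∈ s, L ≤ t) (hne : 0 < s.card) (hp : 0 < Fintype.card (CovIndex p L)) {δ : ℝ}
    (hδ : 0 < δ) (hδ1 : δ < 1) {m : ℕ} (hm : 12 * (Fintype.card (CovIndex p L) : ℝ) / δ ≤ m)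
    (hnet : (2 * m + 1 : ℝ) ^ Fintype.card (CovIndex p L)
      * Real.exp (-(s.card / (8 * max 3 γ ^ (L + 1) * (L + 1)))) ≤ δ / 2) :
    1 - δ ≤ μ.real {ω | ∀ x : CovIndex p L → ℝ, ∑ c, x c ^ 2 = 1 →
      (s.card : ℝ) / 4 ≤ gramForm s (utilde L fun i => u i ω) x} := by
  set good := {ω | ∀ x : CovIndex p L → ℝ, ∑ c, x c ^ 2 = 1 →
      (s.card : ℝ) / 4 ≤ gramForm s (utilde L fun i => u i ω) x} with hgood
  set bad₁ := {ω | 2 * Fintype.card (CovIndex p L) * s.card / δ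
        ≤ ∑ t ∈ s, ∑ c, utilde L (fun i => u i ω) t c ^ 2} with hbad₁
  set bad₂ : (CovIndex p L → Fin (2 * m + 1)) → Set Ω := fun z =>
    {ω | gramForm s (utilde L fun i => u i ω) (gridPoint m z)
      < s.card / 2 * ∑ c, gridPoint m z c ^ 2} with hbad₂
  -- Covering the whole space and using subadditivity avoids any measurability claim about `good`,
  -- an intersection over uncountably many x.
  have hcover : Set.univ ⊆ good ∪ (bad₁ ∪ ⋃ z, bad₂ z) := fun ω _ => by
    by_cases h1 : ω ∈ bad₁
    · exact Or.inr (Or.inl h1)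
    by_cases h2 : ω ∈ ⋃ z, bad₂ z
    · exact Or.inr (Or.inr h2)
    refine Or.inl fun x hx => gramForm_ge_of_grid hδ hδ1 hp hm (le_of_not_ge h1) (fun z => ?_) hx
    exact not_lt.1 fun hz => h2 (Set.mem_iUnion.2 ⟨z, hz⟩)
  have hb1 : μ.real bad₁ ≤ δ / 2 :=
    ENNReal.toReal_le_of_le_ofReal (by positivity) (h.measure_trace_ge_le hs hne hp hδ)
  have hb2 : μ.real (⋃ z, bad₂ z) ≤ δ / 2 := by
    refine (measureReal_iUnion_fintype_le _).trans ?_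
    refine (Finset.sum_le_sum fun z _ => ENNReal.toReal_le_of_le_ofReal (Real.exp_pos _).le
      (h.measure_gramForm_lt_le hs (gridPoint m z))).trans ?_
    simpa using hnet
  have h1 : 1 ≤ μ.real (good ∪ (bad₁ ∪ ⋃ z, bad₂ z)) := by
    rw [← probReal_univ (μ := μ)]
    exact measureReal_mono hcover
  have h2 := measureReal_union_le (μ := μ) good (bad₁ ∪ ⋃ z, bad₂ z)
  have h3 := measureReal_union_le (μ := μ) bad₁ (⋃ z, bad₂ z)
  linarith

end Concentration

/-! ### Sample size and conclusion -/

/-- The sample size makes the union bound over the grid succeed. -/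
theorem net_card_mul_exp_le {d m : ℕ} {n K D δ Λ : ℝ} (hδ : 0 < δ) (hδ1 : δ < 1) (hK : 0 < K)
    (hΛ : 0 < Λ) (hD : 4 ≤ D) (hd : (d : ℝ) ≤ D) (hm : (m : ℝ) ≤ 12 * d / δ + 1)
    (hn : 40 * (K * Λ * (D * Real.log (D / δ))) ≤ n) :
    (2 * m + 1 : ℝ) ^ d * Real.exp (-(n / (8 * K * Λ))) ≤ δ / 2 := by
  set y : ℝ := D / δ with hy
  have hDy : D ≤ y := by
    rw [hy, le_div_iff₀ hδ]; nlinarith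
  have hy4 : 4 ≤ y := hD.trans hDy
  have hlog : 0 ≤ Real.log y := Real.log_nonneg (by linarith)
  -- 2m + 1 ≤ 24y + 3 ≤ 64y ≤ y⁴, as y ≥ 4.
  have hm1 : (2 * m + 1 : ℝ) ≤ y ^ 4 := by
    have h1 : 12 * (d : ℝ) / δ ≤ 12 * y := by
      rw [hy, mul_div_assoc]; gcongr
    have h2 : (64 : ℝ) ≤ y ^ 3 := by
      calc (64 : ℝ) = 4 ^ 3 := by norm_num
        _ ≤ y ^ 3 := by gcongr
    nlinarith [mul_le_mul_of_nonneg_right h2 (show 0 ≤ y by linarith)]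
  have hy0 : 0 < y := by linarith
  have hexp : y ^ 4 = Real.exp (4 * Real.log y) := by
    rw [← Real.exp_log hy0, ← Real.exp_nat_mul, Real.exp_log hy0]; norm_num
  have hδy : 1 / y ≤ δ / 2 := by
    rw [hy, one_div_div]
    gcongr; linarith
  have hinv : 1 / y = Real.exp (-Real.log y) := by
    rw [Real.exp_neg, Real.exp_log hy0, one_div]
  refine le_trans ?_ hδy
  calc (2 * m + 1 : ℝ) ^ d * Real.exp (-(n / (8 * K * Λ)))
      ≤ (y ^ 4) ^ d * Real.exp (-(n / (8 * K * Λ))) := by gcongr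
    _ = Real.exp (d * (4 * Real.log y) + -(n / (8 * K * Λ))) := by
        rw [hexp, ← Real.exp_nat_mul, Real.exp_add]
    _ ≤ Real.exp (-Real.log y) := by
        apply Real.exp_le_exp.2
        -- Here 40 = 8·5: four copies of D log y pay for the grid and the fifth leaves exp(-log y) =
        -- δ/D ≤ δ/2.
        have h1 : 5 * (D * Real.log y) ≤ n / (8 * K * Λ) := by
          rw [le_div_iff₀ (by positivity)]
          linarith
        have h2 : d * Real.log y ≤ D * Real.log y := by gcongr
        nlinarith [mul_le_mul_of_nonneg_right hD hlog]
    _ = 1 / y := hinv.symm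

theorem designMatrix_transpose_mul_self {p : ℕ} (L T : ℕ) (u : ℕ → EuclideanSpace ℝ (Fin p)) :
    (designMatrix L T u)ᵀ * designMatrix L T u
      = ∑ t ∈ Finset.Icc L T, Matrix.vecMulVec (utilde L u t) (utilde L u t) := by
  ext i j
  rw [Matrix.mul_apply, Matrix.sum_apply]
  simp only [designMatrix, Matrix.transpose_apply, Matrix.of_apply, Matrix.vecMulVec_apply]
  exact Finset.sum_coe_sort (Finset.Icc L T) fun t => utilde L u t i * utilde L u t j

theorem theorem2 :
    ∃ C : ℝ, 0 < C ∧
      ∀ (p L T : ℕ) (γ δ : ℝ) (Ω : Type*) [MeasurableSpace Ω] (μ : Measure Ω)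
        [IsProbabilityMeasure μ] (u : ℕ → Ω → EuclideanSpace ℝ (Fin p)),
        1 ≤ p → 1 ≤ L → 0 < δ → δ < 1 →
        InputAssumption μ γ u →
        C * ((L : ℝ) + (L : ℝ) * ((L : ℝ) + 1) * (max 3 γ) ^ (L + 1) *
            (Real.log (((L : ℝ) + 1) / δ) +
              ((p : ℝ) + 1) ^ (L + 1) * Real.log (((p : ℝ) + 1) ^ (L + 1) / δ))) ≤ (T : ℝ) →
        1 - δ ≤ μ.real {ω |
          lambdaMin ((designMatrix L T fun t => u t ω)ᵀ * (designMatrix L T fun t => u t ω)) =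
              lambdaMin (∑ t ∈ Finset.Icc L T,
                Matrix.vecMulVec (utilde L (fun s => u s ω) t) (utilde L (fun s => u s ω) t)) ∧
            ((T : ℝ) - (L : ℝ) + 1) / 4 ≤
              lambdaMin (∑ t ∈ Finset.Icc L T,
                Matrix.vecMulVec (utilde L (fun s => u s ω) t)
                  (utilde L (fun s => u s ω) t))} := by
  refine ⟨40, by norm_num, ?_⟩
  intro p L T γ δ Ω _ μ _ u hp hL hδ hδ1 h hT
  set K : ℝ := max 3 γ ^ (L + 1) with hK
  set D : ℝ := ((p : ℝ) + 1) ^ (L + 1) with hD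
  have hK0 : 0 < K := pow_pos (lt_max_of_lt_left (by norm_num)) _
  have hL1 : (1 : ℝ) ≤ L := by exact_mod_cast hL
  have hp1 : (1 : ℝ) ≤ p := by exact_mod_cast hp
  have hD4 : 4 ≤ D := by
    calc (4 : ℝ) = 2 ^ 2 := by norm_num
      _ ≤ ((p : ℝ) + 1) ^ 2 := by gcongr; linarith
      _ ≤ D := pow_le_pow_right₀ (by linarith) (by omega)
  have hone : ∀ {a : ℝ}, 1 ≤ a → 0 ≤ Real.log (a / δ) := fun ha =>
    Real.log_nonneg ((one_le_div hδ).2 (by linarith))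
  have hlog1 : 0 ≤ Real.log (((L : ℝ) + 1) / δ) := hone (by linarith)
  have hlog2 : 0 ≤ D * Real.log (D / δ) := mul_nonneg (by linarith) (hone (by linarith))
  have hmain : 40 * L + 40 * (K * ((L : ℝ) + 1) * (D * Real.log (D / δ))) ≤ T := by
    refine le_trans ?_ hT
    -- The factor L ≥ 1 and the nonnegative first logarithm only enlarge the right side.
    have h1 : K * ((L : ℝ) + 1) * (D * Real.log (D / δ))
        ≤ L * (K * ((L : ℝ) + 1) * (Real.log (((L : ℝ) + 1) / δ) + D * Real.log (D / δ))) := by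
      refine le_trans ?_ (le_mul_of_one_le_left (by positivity) hL1)
      gcongr
      linarith
    linarith
  have hprod : 0 ≤ K * ((L : ℝ) + 1) * (D * Real.log (D / δ)) := by positivity
  have hLT : L ≤ T := by
    have : (L : ℝ) ≤ T := by linarith
    exact_mod_cast this
  have hcard : ((Finset.Icc L T).card : ℝ) = T - L + 1 := by
    rw [Nat.card_Icc, Nat.cast_sub (by omega)]
    push_cast; ring
  have : Nonempty (CovIndex p L) := ⟨Sum.inl ⟨0, hp⟩⟩
  have hd : (Fintype.card (CovIndex p L) : ℝ) ≤ D := by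
    have := card_covIndex_le (p := p) (L := L)
    rw [hD]
    exact_mod_cast this
  have key := h.persistence_of_excitation (L := L) (s := Finset.Icc L T)
    (fun t ht => (Finset.mem_Icc.1 ht).1) (by rw [Nat.card_Icc]; omega) Fintype.card_pos hδ hδ1
    (Nat.le_ceil _)
    (net_card_mul_exp_le hδ hδ1 hK0 (by positivity) hD4 hd
      (Nat.ceil_lt_add_one (by positivity)).le (by rw [hcard]; linarith))
  refine key.trans (measureReal_mono fun ω hω => ⟨?_, ?_⟩)
  · rw [designMatrix_transpose_mul_self]
  · rw [← hcard]
    exact lambdaMin_gram_ge _ _ hω
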